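/- **Setting.** Let $I,L,d_x,d_z\in\mathbb N_0$. For $i=0,\dots,I$ let $f_i:\mathbb R^{d_x}\times\mathbb R^{d_z}\to\overline{\mathbb R}$ be such that $f_i(\cdot,z)$ is proper, closed and convex for every fixed $z$ and $-f_i(x,\cdot)$ is proper, closed and convex for every fixed $x$. For $\ell=1,\dots,L$ let $c_\ell:\mathbb R^{d_z}\to\overline{\mathbb R}$ be proper, closed and convex, and suppose that the uncertainty set $\mathcal Z=\{z\in\mathbb R^{d_z}: c_\ell(z)\le 0,\ \ell=1,\dots,L\}$ is nonempty. (A function is proper if it is nowhere $-\infty$ and not identically $+\infty$; closed if it is lower semicontinuous and either nowhere or everywhere $-\infty$; convex if its epigraph is convex. For $h$ with values in $\overline{\mathbb R}$, $\operatorname{dom}h=\{h<+\infty\}$, and $\operatorname{ri}$ denotes the relative interior.) Let $f_i^{*1}(w,z)=\sup_{x}\{w^\top x-f_i(x,z)\}$, and let $\lambda f_i^{*1}(w/\lambda,z)$ denote its convex partial perspective: the literal expression for $\lambda>0$; for $\lambda=0$ the value at $w$ of the support function of the domain of the conjugate of $f_i^{*1}(\cdot,z)$; and $+\infty$ for $\lambda<0$.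 The *primal worst problem* is $$\text{(P-W)}\qquad \inf_{x\in\mathbb R^{d_x}}\ \sup_{z_0\in\mathcal Z}f_0(x,z_0)\quad\text{s.t.}\quad \sup_{z_i\in\mathcal Z}f_i(x,z_i)\le 0,\ \ i=1,\dots,I,$$ and the *dual best problem* is $$\text{(D-B)}\qquad \sup_{w,z,\lambda}\ -f_0^{*1}(w_0,z_0)-\sum_{i=1}^I\lambda_i f_i^{*1}(w_i/\lambda_i,z_i)\quad\text{s.t.}\quad \sum_{i=0}^I w_i=0,\quad c_\ell(z_i)\le 0\ \ (0\le i\le I,\ 1\le\ell\le L),\quad -\lambda_i\le 0\ \ (1\le i\le I),$$ with variables $w_0,\dots,w_I\in\mathbb R^{d_x}$, $z_0,\dots,z_I\in\mathbb R^{d_z}$, $\lambda\in\mathbb R^I$. A point is *feasible* in a minimization (maximization) problem if it satisfies all constraints and its objective value is not $+\infty$ (not $-\infty$); the *feasible region* is the set of feasible points. A problem is *solvable* if it has no feasible point (by convention) or if its optimal value is attained at a feasible point. A *strict Slater point* of a problem with constraints $g_k\le 0$, $h_j=0$ is a point that satisfies all constraints, satisfies $g_k<0$ for every $k$, and lies in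 $\operatorname{ri}(\operatorname{dom}g_k)$ and $\operatorname{ri}(\operatorname{dom}h_j)$ for all $k,j$ and in $\operatorname{ri}(\operatorname{dom}g_0)$ for a minimization problem, or $\operatorname{ri}(\operatorname{dom}(-g_0))$ for a maximization problem, with objective function $g_0$. (For (P-W) the constraint functions are $x\mapsto\sup_{z\in\mathcal Z}f_i(x,z)$.) **Theorem (strong duality for (P-W) and (D-B)).** 1. If (P-W) admits a strict Slater point and $\mathcal Z$ is bounded, then the infimum of (P-W) equals the supremum of (D-B) (in $\overline{\mathbb R}$), and (D-B) is solvable. 2. If the feasible region of (P-W) is nonempty and bounded and $\mathcal Z$ is bounded, then the infimum of (P-W) equals the supremum of (D-B), and (P-W) is solvable. 3. If (D-B) admits a strict Slater point (with $\mathcal Z$ possibly unbounded), then the infimum of (P-W) equals the supremum of (D-B), and (P-W) is solvable. -/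

import Mathlib

noncomputable section

namespace RobustDuality

/-- The Euclidean space of dimension `d`. -/
abbrev Vec (d : ℕ) : Type := EuclideanSpace ℝ (Fin d)

/-! ### Extended real-valued convex analysis -/

section ConvexAnalysis

/-- The (effective) domain of an extended real-valued function. -/
def dom {E : Type*} (f : E → EReal) : Set E := {x | f x < ⊤}

/-- A function is proper if it never takes the value `-∞` and is not identically `+∞`. -/
def IsProper {E : Type*} (f : E → EReal) : Prop := (∀ x, ⊥ < f x) ∧ ∃ x, f x < ⊤

/-- A function is closed if it is lower semicontinuous and either nowhere or everywhere `-∞`. -/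
def IsClosedFun {E : Type*} [TopologicalSpace E] (f : E → EReal) : Prop :=
  LowerSemicontinuous f ∧ ((∀ x, ⊥ < f x) ∨ ∀ x, f x = ⊥)

/-- An extended real-valued function is convex if its epigraph is a convex set. -/
def IsConvexFun {E : Type*} [AddCommGroup E] [Module ℝ E] (f : E → EReal) : Prop :=
  Convex ℝ {p : E × ℝ | f p.1 ≤ (p.2 : EReal)}

/-- Proper, closed and convex. -/
def IsPCC {E : Type*} [AddCommGroup E] [Module ℝ E] [TopologicalSpace E] (f : E → EReal) : Prop :=
  IsProper f ∧ IsClosedFun f ∧ IsConvexFun f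

/-- The conjugate `f^*(w) = sup_x (xᵀ w - f x)`. -/
def conj {d : ℕ} (f : Vec d → EReal) (w : Vec d) : EReal :=
  ⨆ x : Vec d, ((inner ℝ x w : ℝ) : EReal) - f x

/-- The support function `sup_{x ∈ X} xᵀ w` of a set `X`. -/
def supportFun {d : ℕ} (X : Set (Vec d)) (w : Vec d) : EReal :=
  ⨆ x ∈ X, ((inner ℝ x w : ℝ) : EReal)

/-- The convex perspective of `f`: it is `t f(x / t)` for `t > 0`, and for `t = 0` it is the
support function of the domain of the conjugate of `f`.  As a function on all of
`ℝ^d × ℝ` it is extended by `+∞` to negative values of `t`. -/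
def perspective {d : ℕ} (f : Vec d → EReal) (x : Vec d) (t : ℝ) : EReal :=
  if 0 < t then (t : EReal) * f (t⁻¹ • x)
  else if t = 0 then supportFun (dom (conj f)) x
  else ⊤

/-- The partial conjugate of `f(x, z)` with respect to its first argument. -/
def partialConj {dx dz : ℕ} (f : Vec dx → Vec dz → EReal) (w : Vec dx) (z : Vec dz) : EReal :=
  conj (fun x => f x z) w

/-- The partial perspective, in the first argument, of the partial conjugate of `f`: this is
`t f^{*1}(w / t, z)`. -/
def partialConjPerspective {dx dz : ℕ} (f : Vec dx → Vec dz → EReal)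
    (w : Vec dx) (t : ℝ) (z : Vec dz) : EReal :=
  perspective (fun w' => partialConj f w' z) w t

end ConvexAnalysis

/-! ### Optimization problems in functional form -/

section Programs

/-- The data of an optimization problem over `E`: an objective, inequality constraints
`ineq i x ≤ 0` and equality constraints `eqn j x = 0`.  It can be read as a minimization or as a
maximization problem. -/
structure Program (E ι κ : Type*) where
  obj : E → EReal
  ineq : ι → E → EReal
  eqn : κ → E → EReal

variable {E ι κ : Type*}

/-- The points that satisfy all constraints. -/
def Program.constraintSet (P : Program E ι κ) : Set E :=
  {x | (∀ i, P.ineq i x ≤ 0) ∧ ∀ j, P.eqn j x = 0}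

/-- The infimum of the minimization problem. -/
def Program.infimum (P : Program E ι κ) : EReal := ⨅ x ∈ P.constraintSet, P.obj x

/-- The supremum of the maximization problem. -/
def Program.supremum (P : Program E ι κ) : EReal := ⨆ x ∈ P.constraintSet, P.obj x

/-- The feasible region of the minimization problem: all constraints hold and the objective is
not `+∞`. -/
def Program.minFeasible (P : Program E ι κ) : Set E := {x ∈ P.constraintSet | P.obj x ≠ ⊤}

/-- The feasible region of the maximization problem: all constraints hold and the objective is
not `-∞`. -/
def Program.maxFeasible (P : Program E ι κ) : Set E := {x ∈ P.constraintSet | P.obj x ≠ ⊥}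

/-- A feasible minimization problem is solvable if its optimal value is attained by a feasible
point; an infeasible one is solvable by convention. -/
def Program.MinSolvable (P : Program E ι κ) : Prop :=
  P.minFeasible.Nonempty → ∃ x ∈ P.minFeasible, P.obj x = P.infimum

/-- A feasible maximization problem is solvable if its optimal value is attained by a feasible
point; an infeasible one is solvable by convention. -/
def Program.MaxSolvable (P : Program E ι κ) : Prop :=
  P.maxFeasible.Nonempty → ∃ x ∈ P.maxFeasible, P.obj x = P.supremum

/-- `x` is a strict Slater point of the constraint set: it is in the relative interior of
the domain of every constraint function, it satisfies all constraints, and it satisfies all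
inequality constraints strictly. -/
def Program.IsStrictSlaterSet [AddCommGroup E] [Module ℝ E] [TopologicalSpace E]
    (P : Program E ι κ) (x : E) : Prop :=
  (∀ i, x ∈ intrinsicInterior ℝ (dom (P.ineq i))) ∧
  (∀ j, x ∈ intrinsicInterior ℝ (dom (P.eqn j))) ∧
  x ∈ P.constraintSet ∧
  ∀ i, P.ineq i x < 0

/-- Strict Slater points of the minimization problem. -/
def Program.IsMinStrictSlater [AddCommGroup E] [Module ℝ E] [TopologicalSpace E]
    (P : Program E ι κ) (x : E) : Prop :=
  P.IsStrictSlaterSet x ∧ x ∈ intrinsicInterior ℝ (dom P.obj)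

/-- Strict Slater points of the maximization problem. -/
def Program.IsMaxStrictSlater [AddCommGroup E] [Module ℝ E] [TopologicalSpace E]
    (P : Program E ι κ) (x : E) : Prop :=
  P.IsStrictSlaterSet x ∧ x ∈ intrinsicInterior ℝ (dom fun y => -P.obj y)

end Programs

/-! ### The robust problem and its dual -/

section Robust

/-- The uncertainty set `{z | c_ℓ(z) ≤ 0 for all ℓ}`. -/
def uncertaintySet {L dz : ℕ} (c : Fin L → Vec dz → EReal) : Set (Vec dz) :=
  {z | ∀ l, c l z ≤ 0}

/-- The worst case `x ↦ sup_{z ∈ Z} f(x, z)`. -/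
def worstCase {dx dz : ℕ} (Z : Set (Vec dz)) (f : Vec dx → Vec dz → EReal) (x : Vec dx) : EReal :=
  ⨆ z ∈ Z, f x z

/-- The primal worst problem (to be minimized): objective `sup_{z ∈ Z} f_0(x, z)`, constraints
`sup_{z ∈ Z} f_i(x, z) ≤ 0` for `i = 1, …, I`. -/
def primalWorst {I L dx dz : ℕ} (f : Fin (I + 1) → Vec dx → Vec dz → EReal)
    (c : Fin L → Vec dz → EReal) : Program (Vec dx) (Fin I) Empty where
  obj := worstCase (uncertaintySet c) (f 0)
  ineq i := worstCase (uncertaintySet c) (f i.succ)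
  eqn := Empty.elim

/-- The decision variables `((w_i)_{i = 0..I}, (z_i)_{i = 0..I}, (λ_i)_{i = 1..I})` of the dual
best problem. -/
abbrev DualVar (I dx dz : ℕ) : Type := (Fin (I + 1) → Vec dx) × (Fin (I + 1) → Vec dz) × (Fin I → ℝ)

/-- The dual best problem (to be maximized): the objective is
`- f_0^{*1}(w_0, z_0) - ∑_i λ_i f_i^{*1}(w_i / λ_i, z_i)`; the inequality constraints are
`-λ_i ≤ 0` for `i = 1, …, I` and `c_ℓ(z_i) ≤ 0` for `i = 0, …, I` and all `ℓ`; the equality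
constraints are the coordinates of `∑_i w_i = 0`. -/
def dualBest {I L dx dz : ℕ} (f : Fin (I + 1) → Vec dx → Vec dz → EReal)
    (c : Fin L → Vec dz → EReal) :
    Program (DualVar I dx dz) (Fin I ⊕ (Fin (I + 1) × Fin L)) (Fin dx) where
  obj := fun (w, z, lam) =>
    - partialConj (f 0) (w 0) (z 0)
      - ∑ i : Fin I, partialConjPerspective (f i.succ) (w i.succ) (lam i) (z i.succ)
  ineq := Sum.elim
    (fun i (_, _, lam) => ((-lam i : ℝ) : EReal))
    (fun p (_, z, _) => c p.2 (z p.1))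
  eqn := fun k (w, _, _) => (((∑ i, w i) k : ℝ) : EReal)

end Robust

end RobustDuality

end

/-!
Every partial function of `f i` and of its negative is proper, so the data are real-valued
functions `g i`. With the Lagrangian `L(x; μ, ζ) = ∑ i, μ i * g i x (ζ i)`, normalized by `μ 0 = 1`,
the primal worst problem is `inf_x sup_{μ, ζ} L`. Splitting the affine minorants of the sum
`L(·; μ, ζ)` into affine minorants of its summands shows that the dual best problem is
`sup_{μ, ζ} inf_x L`.

The Lagrangian is not jointly concave in `(μ, ζ)`, but the set of lower bounds it attains is convex,
because the `ζ i` can be mixed with weights proportional to the multipliers.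

If the uncertainty set is compact, convex Lagrange multipliers for the worst-case functions reduce
the claim to a minimax over `ζ` with `μ` fixed, where `L` is concave in `ζ` and Sion's theorem
applies. Boundedness of the feasible region replaces Slater's condition at the price of an
arbitrarily small loss, as the constraints can then be relaxed slightly without changing the value
by much. In the presence of a dual Slater point, `0` is a relative core point of the projection of
the hypograph of the perturbed dual value. The slope of a functional supporting the hypograph over
`0` is an optimal `x`.
-/

noncomputable section

namespace RobustDuality

open Set Filter Topology

section Separation

theorem nonneg_of_forall_le_add_mul {a b c : ℝ} (h : ∀ t, 0 ≤ t → a ≤ b + t * c) : 0 ≤ c := by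
  by_contra! hc
  have ht := h (max ((a - b - 1) / c) 0) (le_max_right _ _)
  have := mul_le_mul_of_nonpos_right (le_max_left ((a - b - 1) / c) 0) hc.le
  rw [div_mul_cancel₀ _ hc.ne] at this
  linarith

/-- The cone generated by a nonempty convex set, with its apex. -/
def coneOfConvex {V : Type*} [AddCommGroup V] [Module ℝ V] {S : Set V} (hS : Convex ℝ S)
    (hne : S.Nonempty) : PointedCone ℝ V where
  carrier := {y | ∃ t : ℝ, 0 ≤ t ∧ ∃ x ∈ S, t • x = y}
  zero_mem' := ⟨0, le_rfl, hne.some, hne.some_mem, zero_smul _ _⟩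
  add_mem' := by
    rintro _ _ ⟨a, ha, x, hx, rfl⟩ ⟨b, hb, y, hy, rfl⟩
    obtain ⟨z, hz, h⟩ := (hS.add_smul ha hb).ge
      (Set.add_mem_add (Set.smul_mem_smul_set hx) (Set.smul_mem_smul_set hy))
    exact ⟨a + b, add_nonneg ha hb, z, hz, h⟩
  smul_mem' := by
    rintro c _ ⟨t, ht, x, hx, rfl⟩
    exact ⟨c * t, mul_nonneg c.2 ht, x, hx, mul_smul _ _ _⟩

variable {V : Type*} [AddCommGroup V] [Module ℝ V] {K : Set (V × ℝ)} {v : ℝ}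

theorem exists_linear_extension_of_convex_of_absorbing (hK : Convex ℝ K) (p : Submodule ℝ V)
    (f : V →ₗ[ℝ] ℝ) (hf : ∀ q ∈ K, q.1 ∈ p → q.2 ≤ v + f q.1)
    (habs : ∀ u : V, ∃ s > (0 : ℝ), ∃ r, (s • u, r) ∈ K) :
    ∃ φ : V →ₗ[ℝ] ℝ, (∀ u ∈ p, φ u = f u) ∧ ∀ q ∈ K, q.2 ≤ v + φ q.1 := by
  let gap : V × ℝ →ᵃ[ℝ] V × ℝ :=
    AffineMap.prodMap (AffineMap.id ℝ V) (AffineMap.const ℝ ℝ v - AffineMap.id ℝ ℝ)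
  have hgap : ∀ u a, gap (u, a) = (u, v - a) := fun _ _ => rfl
  obtain ⟨_, -, r₀, hr₀⟩ := habs 0
  let C := coneOfConvex (hK.affine_preimage gap) ⟨(_, v - r₀), by simpa [hgap] using hr₀⟩
  have mem_C {s : ℝ} (hs : 0 ≤ s) {u : V} {r : ℝ} (h : (u, r) ∈ K) : (s • u, s * (v - r)) ∈ C :=
    ⟨s, hs, (u, v - r), by simpa [hgap] using h, rfl⟩
  obtain ⟨g, hg, hgC⟩ := riesz_extension C
    ⟨p.prod ⊤, (f.coprod LinearMap.id).domRestrict (p.prod ⊤)⟩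
    (by
      rintro ⟨_, hp⟩ ⟨t, ht, ⟨u, a⟩, hx, rfl⟩
      change 0 ≤ f (t • u) + t * a
      rcases ht.eq_or_lt with rfl | ht
      · simp
      have hu : u ∈ p := (p.smul_mem_iff ht.ne').1 hp.1
      have : v - a ≤ v + f u := hf _ hx hu
      rw [map_smul, smul_eq_mul]
      nlinarith)
    (by
      rintro ⟨u, a⟩
      obtain ⟨s, hs, r, hr⟩ := habs u
      refine ⟨⟨(0, s⁻¹ * (v - r) - a), p.zero_mem, trivial⟩, ?_⟩
      simpa [smul_smul, hs.ne'] using mem_C (inv_nonneg.2 hs.le) hr)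
  have hg_split (u : V) (a : ℝ) : g (u, a) = g (u, 0) + a := by
    have hga : g (0, a) = a := by simpa using hg ⟨(0, a), p.zero_mem, trivial⟩
    rw [← hga, ← map_add, Prod.mk_add_mk, add_zero, zero_add, hga]
  refine ⟨g ∘ₗ LinearMap.inl ℝ V ℝ, fun u hu => ?_, fun ⟨u, r⟩ hr => ?_⟩
  · simpa using hg ⟨(u, 0), hu, trivial⟩
  · have := hgC _ (mem_C zero_le_one hr)
    rw [one_smul, one_mul, hg_split] at this
    simp only [LinearMap.comp_apply, LinearMap.inl_apply]
    linarith

theorem exists_pos_smul_mem_of_mem_span {A : Set V} (hA : Convex ℝ A) (h0 : (0 : V) ∈ A)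
    (hcore : ∀ a ∈ A, ∃ s < (0 : ℝ), s • a ∈ A) {u : V} (hu : u ∈ Submodule.span ℝ A) :
    ∃ s > (0 : ℝ), s • u ∈ A := by
  induction hu using Submodule.span_induction with
  | mem x hx => exact ⟨1, one_pos, by simpa using hx⟩
  | zero => exact ⟨1, one_pos, by simpa using h0⟩
  | add x y _ _ hx hy =>
    obtain ⟨s, hs, hx⟩ := hx
    obtain ⟨t, ht, hy⟩ := hy
    refine ⟨s * t / (s + t), by positivity, ?_⟩
    have := hA hx hy (a := t / (s + t)) (b := s / (s + t)) (by positivity) (by positivity)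
      (by field_simp; ring)
    convert this using 1
    rw [smul_add, smul_smul, smul_smul]
    congr 2 <;> ring
  | smul c x _ hx =>
    obtain ⟨s, hs, hx⟩ := hx
    rcases lt_trichotomy c 0 with hc | rfl | hc
    · obtain ⟨t, ht, hx⟩ := hcore _ hx
      refine ⟨t * s / c, div_pos_of_neg_of_neg (mul_neg_of_neg_of_pos ht hs) hc, ?_⟩
      rwa [smul_smul, div_mul_cancel₀ _ hc.ne, mul_smul]
    · exact ⟨1, one_pos, by simpa using h0⟩
    · exact ⟨s / c, by positivity, by rwa [smul_smul, div_mul_cancel₀ _ hc.ne']⟩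

theorem exists_linear_bound_of_convex_of_mem_core (hK : Convex ℝ K) {r₀ : ℝ} (h₀ : (0, r₀) ∈ K)
    (hv : ∀ r, (0, r) ∈ K → r ≤ v) (hcore : ∀ q ∈ K, ∃ s < (0 : ℝ), ∃ r, (s • q.1, r) ∈ K) :
    ∃ φ : V →ₗ[ℝ] ℝ, ∀ q ∈ K, q.2 ≤ v + φ q.1 := by
  let A : Set V := Prod.fst '' K
  let U := Submodule.span ℝ A
  have hA : Convex ℝ A := hK.linear_image (LinearMap.fst ℝ V ℝ)
  have habs (u : U) : ∃ s > (0 : ℝ), ∃ r, ((s • u : U).1, r) ∈ K := by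
    obtain ⟨s, hs, ⟨_, r⟩, hr, rfl⟩ := exists_pos_smul_mem_of_mem_span hA ⟨_, h₀, rfl⟩
      (by
        rintro _ ⟨q, hq, rfl⟩
        obtain ⟨s, hs, r, hr⟩ := hcore q hq
        exact ⟨s, hs, _, hr, rfl⟩) u.2
    exact ⟨s, hs, r, hr⟩
  obtain ⟨φ, -, hφ⟩ := exists_linear_extension_of_convex_of_absorbing
    (hK.linear_preimage (U.subtype.prodMap LinearMap.id)) ⊥ 0
    (by
      rintro ⟨_, r⟩ hr rfl
      simpa using hv r hr) habs
  obtain ⟨ψ, rfl⟩ := LinearMap.exists_extend φ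
  exact ⟨ψ, fun q hq => hφ (⟨q.1, Submodule.subset_span ⟨q, hq, rfl⟩⟩, q.2) hq⟩

end Separation

section RealConvexDuality

variable {E : Type*} [AddCommGroup E] [Module ℝ E]

theorem exists_linear_extension_of_concaveOn {h : E → ℝ} (hh : ConcaveOn ℝ univ h)
    (p : Submodule ℝ E) (f : E →ₗ[ℝ] ℝ) {v : ℝ} (hf : ∀ u ∈ p, h u ≤ v + f u) :
    ∃ φ : E →ₗ[ℝ] ℝ, (∀ u ∈ p, φ u = f u) ∧ ∀ u, h u ≤ v + φ u := by
  obtain ⟨φ, hφp, hφ⟩ := exists_linear_extension_of_convex_of_absorbing hh.convex_hypograph p f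
    (fun q hq hqp => hq.2.trans (hf _ hqp)) fun u => ⟨1, one_pos, h ((1 : ℝ) • u), trivial, le_rfl⟩
  exact ⟨φ, hφp, fun u => hφ (u, h u) ⟨trivial, le_rfl⟩⟩

theorem exists_subgradient {g : E → ℝ} (hg : ConvexOn ℝ univ g) (x : E) :
    ∃ φ : E →ₗ[ℝ] ℝ, ∀ y, g x + φ (y - x) ≤ g y := by
  obtain ⟨φ, -, hφ⟩ := exists_linear_extension_of_concaveOn (h := fun u => -g (x + u)) (v := -g x)
    (hg.translate_right x).neg ⊥ 0
    (by
      rintro _ rfl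
      simp)
  refine ⟨-φ, fun y => ?_⟩
  have := hφ (y - x)
  rw [add_sub_cancel] at this
  simp only [LinearMap.neg_apply]
  linarith

variable {ι : Type*}

theorem convexOn_sum {s : Finset ι} {S : Set E} (hS : Convex ℝ S) {h : ι → E → ℝ}
    (hh : ∀ i ∈ s, ConvexOn ℝ S (h i)) : ConvexOn ℝ S fun x => ∑ i ∈ s, h i x := by
  classical
  induction s using Finset.induction_on with
  | empty => simpa using convexOn_const 0 hS
  | insert i s hi ih =>
    rw [Finset.forall_mem_insert] at hh
    simp only [Finset.sum_insert hi]
    exact hh.1.add (ih hh.2)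

theorem exists_linear_split_of_le_sum [Fintype ι] [Nonempty ι] {h : ι → E → ℝ}
    (hh : ∀ i, ConvexOn ℝ univ (h i)) {m : ℝ} {u : E →ₗ[ℝ] ℝ} (hm : ∀ x, m + u x ≤ ∑ i, h i x) :
    ∃ w : ι → E →ₗ[ℝ] ℝ, ∑ i, w i = u ∧ ∀ x : ι → E, m + ∑ i, w i (x i) ≤ ∑ i, h i (x i) := by
  classical
  let diag : E →ₗ[ℝ] ι → E := LinearMap.pi fun _ => LinearMap.id
  have hconv : ConvexOn ℝ univ fun x : ι → E => ∑ i, h i (x i) :=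
    convexOn_sum convex_univ fun i _ =>
      (hh i).comp_linearMap (LinearMap.proj (R := ℝ) (φ := fun _ => E) i)
  obtain ⟨φ, hφ_diag, hφ⟩ := exists_linear_extension_of_concaveOn hconv.neg (v := -m)
    (LinearMap.range diag) (-(u ∘ₗ LinearMap.proj (Classical.arbitrary ι)))
    (by
      rintro _ ⟨x, rfl⟩
      have : -∑ i, h i x ≤ -m + -u x := by linarith [hm x]
      exact this)
  let w (i : ι) : E →ₗ[ℝ] ℝ := -(φ ∘ₗ LinearMap.single ℝ (fun _ => E) i)
  have hw (x : ι → E) : ∑ i, w i (x i) = -φ x := by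
    conv_rhs => rw [← Finset.univ_sum_single x, map_sum]
    simp [w]
  refine ⟨w, LinearMap.ext fun x => ?_, fun x => ?_⟩
  · rw [LinearMap.sum_apply, hw fun _ => x]
    exact neg_eq_iff_eq_neg.2 (hφ_diag _ ⟨x, rfl⟩)
  · have : -∑ i, h i (x i) ≤ -m + φ x := hφ x
    rw [hw]
    linarith

section Lagrange

variable {F₀ : E → ℝ} {F : ι → E → ℝ}

theorem convex_perturbation_hypograph (h₀ : ConvexOn ℝ univ F₀) (hF : ∀ i, ConvexOn ℝ univ (F i)) :
    Convex ℝ {q : (ι → ℝ) × ℝ | ∃ x, F₀ x ≤ -q.2 ∧ ∀ i, F i x ≤ q.1 i} := by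
  rintro ⟨u, r⟩ ⟨x, hx₀, hx⟩ ⟨u', r'⟩ ⟨x', hx₀', hx'⟩ a b ha hb hab
  have mix {G : E → ℝ} (hG : ConvexOn ℝ univ G) {s t : ℝ} (hs : G x ≤ s) (ht : G x' ≤ t) :
      G (a • x + b • x') ≤ a * s + b * t :=
    (hG.2 trivial trivial ha hb hab).trans
      (add_le_add (mul_le_mul_of_nonneg_left hs ha) (mul_le_mul_of_nonneg_left ht hb))
  refine ⟨a • x + b • x', (mix h₀ hx₀ hx₀').trans_eq ?_, fun i => mix (hF i) (hx i) (hx' i)⟩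
  simp only [Prod.snd_add, Prod.smul_snd, smul_eq_mul]
  ring

theorem exists_lagrange_multipliers_of_slater [Fintype ι] (h₀ : ConvexOn ℝ univ F₀)
    (hF : ∀ i, ConvexOn ℝ univ (F i)) {x₀ : E} (hx₀ : ∀ i, F i x₀ < 0) {m : ℝ}
    (hm : ∀ x, (∀ i, F i x ≤ 0) → m ≤ F₀ x) :
    ∃ l : ι → ℝ, (∀ i, 0 ≤ l i) ∧ ∀ x, m ≤ F₀ x + ∑ i, l i * F i x := by
  classical
  obtain ⟨φ, -, hφ⟩ := exists_linear_extension_of_convex_of_absorbing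
    (convex_perturbation_hypograph h₀ hF) (v := -m) ⊥ 0
    (by
      rintro ⟨_, r⟩ ⟨x, hx, hFx⟩ rfl
      have : F₀ x ≤ -r := hx
      simpa using by linarith [hm x hFx])
    (fun u => by
      have hsmall (i : ι) : ∀ᶠ s in 𝓝[>] (0 : ℝ), F i x₀ < s * u i := by
        refine nhdsWithin_le_nhds (ContinuousAt.eventually_lt ?_ ?_ ?_)
        · exact continuousAt_const
        · fun_prop
        · simpa using hx₀ i
      obtain ⟨s, hs, hpos⟩ := ((eventually_all.2 hsmall).and self_mem_nhdsWithin).exists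
      exact ⟨s, hpos, -F₀ x₀, x₀, (neg_neg _).ge, fun i => (hs i).le⟩)
  have hφ_sum (u : ι → ℝ) : φ u = ∑ i, φ (Pi.single i 1) * u i := by
    conv_lhs => rw [LinearMap.pi_apply_eq_sum_univ φ u]
    refine Finset.sum_congr rfl fun i _ => ?_
    rw [smul_eq_mul, mul_comm]
    congr 2
    ext j
    simp [Pi.single_apply, eq_comm]
  refine ⟨fun i => φ (Pi.single i 1), fun i => ?_, fun x => ?_⟩
  · refine nonneg_of_forall_le_add_mul (a := -F₀ x₀) (b := -m + φ fun j => F j x₀) fun t ht => ?_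
    have := hφ ((fun j => F j x₀) + t • Pi.single i 1, -F₀ x₀)
      ⟨x₀, (neg_neg _).ge, fun j => le_add_of_nonneg_right
        (smul_nonneg ht (Pi.single_nonneg.2 zero_le_one : (0 : ι → ℝ) ≤ _) j)⟩
    simpa [add_assoc] using this
  · have := hφ (fun j => F j x, -F₀ x) ⟨x, (neg_neg _).ge, fun _ => le_rfl⟩
    rw [hφ_sum] at this
    simp only at this
    linarith

end Lagrange

end RealConvexDuality

section Compactness

variable {ι : Type*}

theorem exists_pos_forall_exists_lt_of_isCompact {X : Type*} [TopologicalSpace X] {T : Set X}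
    (hT : IsCompact T) {F : ι → X → ℝ} (hF : ∀ i, LowerSemicontinuous (F i))
    (hpos : ∀ x ∈ T, ∃ i, 0 < F i x) : ∃ ε > 0, ∀ x ∈ T, ∃ i, ε < F i x := by
  refine hT.induction_on ⟨1, one_pos, fun _ => False.elim⟩ ?_ ?_ fun x hx => ?_
  · rintro S S' hSS' ⟨ε, hε, h⟩
    exact ⟨ε, hε, fun x hx => h x (hSS' hx)⟩
  · rintro S S' ⟨ε, hε, h⟩ ⟨ε', hε', h'⟩
    refine ⟨min ε ε', lt_min hε hε', ?_⟩
    rintro x (hx | hx)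
    · exact (h x hx).imp fun _ => (min_le_left _ _).trans_lt
    · exact (h' x hx).imp fun _ => (min_le_right _ _).trans_lt
  · obtain ⟨i, hi⟩ := hpos x hx
    exact ⟨_, mem_nhdsWithin_of_mem_nhds (hF i x _ (half_lt_self hi)), _, half_pos hi,
      fun y hy => ⟨i, hy⟩⟩

theorem exists_pos_isBounded_sublevel {E : Type*} [NormedAddCommGroup E] [NormedSpace ℝ E]
    [ProperSpace E] {F : ι → E → ℝ} (hF : ∀ i, QuasiconvexOn ℝ univ (F i))
    (hFl : ∀ i, LowerSemicontinuous (F i)) (hne : {x | ∀ i, F i x ≤ 0}.Nonempty)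
    (hbd : Bornology.IsBounded {x | ∀ i, F i x ≤ 0}) :
    ∃ ε > 0, Bornology.IsBounded {x | ∀ i, F i x ≤ ε} := by
  obtain ⟨a, ha⟩ := hne
  obtain ⟨R, hR⟩ := hbd.subset_ball a
  have hR0 : 0 < R := Metric.pos_of_mem_ball (hR ha)
  obtain ⟨ε, hε, hsphere⟩ := exists_pos_forall_exists_lt_of_isCompact (isCompact_sphere a R) hFl
    (by
      intro x hx
      by_contra! hfeas
      exact (Metric.mem_ball.1 (hR hfeas)).ne hx)
  refine ⟨ε, hε, (Metric.isBounded_closedBall (x := a) (r := R)).subset fun x hx => ?_⟩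
  by_contra hxR
  rw [Metric.mem_closedBall, not_le] at hxR
  have hθ : R / dist x a ∈ Icc (0 : ℝ) 1 := ⟨by positivity, (div_le_one (hR0.trans hxR)).2 hxR.le⟩
  obtain ⟨i, hi⟩ := hsphere (AffineMap.lineMap a x (R / dist x a)) (by
    rw [mem_sphere_iff_norm, ← dist_eq_norm, dist_lineMap_left, Real.norm_of_nonneg hθ.1,
      dist_comm a x, div_mul_cancel₀ _ (hR0.trans hxR).ne'])
  have := (hF i ε).lineMap_mem ⟨trivial, (ha i).trans hε.le⟩ ⟨trivial, hx i⟩ hθ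
  exact hi.not_ge this.2

theorem exists_lagrange_multipliers_of_isBounded [Fintype ι] {E : Type*} [NormedAddCommGroup E]
    [NormedSpace ℝ E] [FiniteDimensional ℝ E] {F₀ : E → ℝ} {F : ι → E → ℝ}
    (h₀ : ConvexOn ℝ univ F₀) (hF : ∀ i, ConvexOn ℝ univ (F i))
    (hne : {x | ∀ i, F i x ≤ 0}.Nonempty) (hbd : Bornology.IsBounded {x | ∀ i, F i x ≤ 0})
    {m t : ℝ} (hm : ∀ x, (∀ i, F i x ≤ 0) → m ≤ F₀ x) (ht : t < m) :
    ∃ l : ι → ℝ, (∀ i, 0 ≤ l i) ∧ ∀ x, t ≤ F₀ x + ∑ i, l i * F i x := by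
  have := FiniteDimensional.proper_real E
  have hc {G : E → ℝ} (hG : ConvexOn ℝ univ G) : Continuous G :=
    continuousOn_univ.1 (hG.continuousOn isOpen_univ)
  obtain ⟨δ, hδ, hδ_bd⟩ := exists_pos_isBounded_sublevel (fun i => (hF i).quasiconvexOn)
    (fun i => (hc (hF i)).lowerSemicontinuous) hne hbd
  have hT : IsCompact ({x | ∀ i, F i x ≤ δ} ∩ {x | F₀ x ≤ t}) := by
    refine (Metric.isCompact_of_isClosed_isBounded ?_ hδ_bd).inter_right
      (isClosed_le (hc h₀) continuous_const)
    rw [ofPred_forall]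
    exact isClosed_iInter fun i => isClosed_le (hc (hF i)) continuous_const
  obtain ⟨ε, hε, hεT⟩ := exists_pos_forall_exists_lt_of_isCompact hT
    (fun i => (hc (hF i)).lowerSemicontinuous)
    (by
      intro x hx
      by_contra! hfeas
      exact (ht.trans_le (hm x hfeas)).not_ge hx.2)
  obtain ⟨a, ha⟩ := hne
  obtain ⟨l, hl, hlag⟩ := exists_lagrange_multipliers_of_slater h₀
    (F := fun i x => F i x + -min δ ε) (x₀ := a) (m := t) (fun i => (hF i).add_const _)
    (fun i => by linarith [ha i, lt_min hδ hε])
    (by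
      intro x hx
      by_contra! hxt
      obtain ⟨i, hi⟩ := hεT x ⟨fun i => by linarith [hx i, min_le_left δ ε], hxt.le⟩
      linarith [hx i, min_le_right δ ε])
  refine ⟨l, hl, fun x => (hlag x).trans ?_⟩
  gcongr with i
  · exact hl i
  · linarith [lt_min hδ hε]

theorem exists_forall_le_of_forall_exists_le {E F β : Type*} [LinearOrder β] [DenselyOrdered β]
    [TopologicalSpace E] [AddCommGroup E] [Module ℝ E] [IsTopologicalAddGroup E]
    [ContinuousSMul ℝ E] [TopologicalSpace F] [AddCommGroup F] [Module ℝ F]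
    [IsTopologicalAddGroup F] [ContinuousSMul ℝ F] {Z : Set F} (hne : Z.Nonempty)
    (hZ : IsCompact Z) (hZc : Convex ℝ Z) {h : E → F → β}
    (hx : ∀ z ∈ Z, QuasiconvexOn ℝ univ fun x => h x z)
    (hxl : ∀ z ∈ Z, LowerSemicontinuous fun x => h x z)
    (hz : ∀ x, QuasiconcaveOn ℝ Z (h x)) (hzu : ∀ x, UpperSemicontinuousOn (h x) Z)
    {m : β} (hm : ∀ x, ∃ z ∈ Z, m ≤ h x z) : ∃ z ∈ Z, ∀ x, m ≤ h x z := by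
  by_contra! hlt
  obtain ⟨s, hs⟩ := (UpperSemicontinuousOn.inter_biInter_preimage_Ici_eq_empty_iff_exists_finset
    hZ (I := univ) (c := m) fun x _ => hzu x).1 (by
      ext z
      simpa using hlt z)
  obtain ⟨x, -, hxm⟩ := Sion.exists_lt_iInf_of_lt_iInf_of_finite
    (f := fun z x => OrderDual.toDual (h x z)) (t := OrderDual.toDual m) hne hZ
    (fun x _ => hzu x) (fun x _ => (hz x).dual) convex_univ
    (fun z hzZ => (hxl z hzZ).lowerSemicontinuousOn univ) (fun z hzZ => (hx z hzZ).dual) hZc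
    (s.finite_toSet.image Subtype.val) (subset_univ _)
    (by
      intro z hzZ
      obtain ⟨x, hxs, hx⟩ := hs z hzZ
      exact ⟨x, mem_image_of_mem _ hxs, hx⟩)
  obtain ⟨z, hzZ, hz⟩ := hm x
  exact (hxm z hzZ).not_ge hz

end Compactness

section ExtendedReals

theorem ereal_coe_sum {ι : Type*} (s : Finset ι) (r : ι → ℝ) :
    ((∑ i ∈ s, r i : ℝ) : EReal) = ∑ i ∈ s, (r i : EReal) :=
  map_sum (⟨⟨Real.toEReal, EReal.coe_zero⟩, EReal.coe_add⟩ : ℝ →+ EReal) r s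

theorem iSup_coe_ne_bot {X : Type*} [Nonempty X] (h : X → ℝ) : ⨆ x, (h x : EReal) ≠ ⊥ :=
  fun hbot => EReal.coe_ne_bot _ (iSup_eq_bot.1 hbot (Classical.arbitrary X))

theorem sum_iSup_eq_iSup_sum {ι X : Type*} [Nonempty X] (s : Finset ι) (h : ι → X → EReal) :
    ∑ i ∈ s, ⨆ x, h i x = ⨆ x : ι → X, ∑ i ∈ s, h i (x i) := by
  classical
  refine le_antisymm ?_ (iSup_le fun x => Finset.sum_le_sum fun i _ => le_iSup (h i) (x i))
  induction s using Finset.induction_on with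
  | empty => simp
  | insert i s hi ih =>
    rw [Finset.sum_insert hi]
    refine EReal.add_le_of_forall_lt fun a ha b hb => ?_
    obtain ⟨x, hx⟩ := lt_iSup_iff.1 ha
    obtain ⟨y, hy⟩ := lt_iSup_iff.1 (hb.trans_le ih)
    refine le_iSup_of_le (Function.update y i x) ?_
    rw [Finset.sum_insert hi, Function.update_self]
    refine add_le_add hx.le (hy.le.trans_eq (Finset.sum_congr rfl fun j hj => ?_))
    rw [Function.update_of_ne (ne_of_mem_of_not_mem hj hi)]

end ExtendedReals

section Conjugates

variable {d : ℕ} {g : Vec d → ℝ} {w : Vec d}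

theorem conj_coe : conj (fun x => (g x : EReal)) w = ⨆ x, ((inner ℝ x w - g x : ℝ) : EReal) := by
  simp only [conj, EReal.coe_sub]

theorem dom_conj_conj_coe : dom (conj (conj fun x => (g x : EReal))) = univ := by
  refine eq_univ_of_forall fun x => lt_of_le_of_lt (iSup_le fun v => ?_) (EReal.coe_lt_top (g x))
  have hv : ((inner ℝ x v - g x : ℝ) : EReal) ≤ conj (fun x => (g x : EReal)) v :=
    conj_coe.ge.trans' (le_iSup (fun x => ((inner ℝ x v - g x : ℝ) : EReal)) x)
  refine (EReal.sub_le_sub le_rfl hv).trans_eq ?_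
  rw [real_inner_comm, ← EReal.coe_sub, sub_sub_cancel]

theorem perspective_conj_coe {t : ℝ} (ht : 0 ≤ t) :
    perspective (conj fun x => (g x : EReal)) w t =
      ⨆ x, ((inner ℝ x w - t * g x : ℝ) : EReal) := by
  rcases ht.eq_or_lt with rfl | ht
  · simp only [perspective, lt_irrefl, if_false, if_true, supportFun, dom_conj_conj_coe, mem_univ,
      iSup_pos, zero_mul, sub_zero]
  have ht' : (0 : EReal) < t := by exact_mod_cast ht
  rw [perspective, if_pos ht, conj_coe]
  refine eq_of_forall_ge_iff fun M => ?_
  rw [mul_comm, ← EReal.le_div_iff_mul_le ht' (EReal.coe_ne_top t), iSup_le_iff, iSup_le_iff]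
  refine forall_congr' fun x => ?_
  rw [EReal.le_div_iff_mul_le ht' (EReal.coe_ne_top t), ← EReal.coe_mul, inner_smul_right, sub_mul,
    mul_right_comm, inv_mul_cancel₀ ht.ne', one_mul, mul_comm (g x)]

end Conjugates

section Slater

variable {E : Type*} [AddCommGroup E] [Module ℝ E]

theorem IsConvexFun.comp_linearMap {E' : Type*} [AddCommGroup E'] [Module ℝ E'] {h : E → EReal}
    (hh : IsConvexFun h) (A : E' →ₗ[ℝ] E) : IsConvexFun fun x => h (A x) :=
  Convex.linear_preimage hh (A.prodMap LinearMap.id)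

theorem isConvexFun_coe_iff {h : E → ℝ} :
    IsConvexFun (fun x => (h x : EReal)) ↔ ConvexOn ℝ univ h := by
  simp [IsConvexFun, convexOn_iff_convex_epigraph]

theorem IsConvexFun.convex_sublevel_zero {h : E → EReal} (hh : IsConvexFun h) :
    Convex ℝ {x | h x ≤ 0} := by
  simpa using hh.linear_preimage (LinearMap.inl ℝ E ℝ)

theorem IsConvexFun.eventually_lineMap_neg {h : E → EReal} (hh : IsConvexFun h) {a b : E}
    (ha : h a < 0) (hb : h b < ⊤) : ∀ᶠ θ in 𝓝[>] (0 : ℝ), h (AffineMap.lineMap a b θ) < 0 := by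
  obtain ⟨α, haα, hα⟩ := EReal.lt_iff_exists_real_btwn.1 ha
  obtain ⟨β, hbβ, -⟩ := EReal.lt_iff_exists_real_btwn.1 hb
  have hneg : ∀ᶠ θ in 𝓝[>] (0 : ℝ), AffineMap.lineMap α β θ < 0 := by
    refine nhdsWithin_le_nhds (ContinuousAt.eventually_lt ?_ continuousAt_const ?_)
    · exact AffineMap.lineMap_continuous.continuousAt
    · simpa using hα
  filter_upwards [hneg, Ioo_mem_nhdsGT one_pos] with θ hθ hθ01
  have hle : h (AffineMap.lineMap a b θ) ≤ (AffineMap.lineMap α β θ : ℝ) := by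
    have := Convex.lineMap_mem (s := {p : E × ℝ | h p.1 ≤ p.2}) hh (x := (a, α)) (y := (b, β))
      haα.le hbβ.le ⟨hθ01.1.le, hθ01.2.le⟩
    rwa [mem_ofPred_eq, AffineMap.fst_lineMap, AffineMap.snd_lineMap] at this
  exact hle.trans_lt (by exact_mod_cast hθ)

variable [TopologicalSpace E] [IsTopologicalAddGroup E] [ContinuousSMul ℝ E]

theorem eventually_lineMap_mem_of_mem_intrinsicInterior {S : Set E} {p q : E}
    (hp : p ∈ intrinsicInterior ℝ S) (hq : q ∈ affineSpan ℝ S) :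
    ∀ᶠ s in 𝓝 (0 : ℝ), AffineMap.lineMap p q s ∈ S := by
  obtain ⟨p₀, hp₀, rfl⟩ := mem_intrinsicInterior.1 hp
  let γ (s : ℝ) : affineSpan ℝ S :=
    ⟨AffineMap.lineMap (p₀ : E) q s, AffineMap.lineMap_mem s p₀.2 hq⟩
  have hγ : Continuous γ := AffineMap.lineMap_continuous.subtype_mk _
  have hγ0 : γ 0 = p₀ := Subtype.ext (AffineMap.lineMap_apply_zero _ _)
  have hS : (Subtype.val ⁻¹' S : Set (affineSpan ℝ S)) ∈ 𝓝 (γ 0) := by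
    rw [hγ0]
    exact mem_interior_iff_mem_nhds.1 hp₀
  exact hγ.continuousAt hS

theorem Program.IsMaxStrictSlater.exists_neg_lineMap_mem {ι κ : Type*} [Finite ι]
    {P : Program E ι κ} (hP : ∀ i, IsConvexFun (P.ineq i)) {y y' : E} (hy : P.IsMaxStrictSlater y)
    (hy' : ∀ i, P.ineq i y' < ⊤) (hobj : y' ∈ dom fun y => -P.obj y) :
    ∃ s < (0 : ℝ), (∀ i, P.ineq i (AffineMap.lineMap y y' s) ≤ 0) ∧
      AffineMap.lineMap y y' s ∈ dom fun y => -P.obj y := by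
  have hdom : ∀ᶠ s in 𝓝[<] (0 : ℝ), ∀ i, P.ineq i (AffineMap.lineMap y y' s) < ⊤ :=
    nhdsWithin_le_nhds (eventually_all.2 fun i =>
      eventually_lineMap_mem_of_mem_intrinsicInterior (hy.1.1 i)
        (subset_affineSpan ℝ _ (hy' i)))
  obtain ⟨s, hs_dom, hs⟩ := (hdom.and self_mem_nhdsWithin).exists
  have hneg : ∀ᶠ θ in 𝓝[>] (0 : ℝ), ∀ i, P.ineq i (AffineMap.lineMap y y' (θ * s)) < 0 :=
    eventually_all.2 fun i => by
      simpa only [AffineMap.lineMap_lineMap_right] using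
        (hP i).eventually_lineMap_neg (hy.1.2.2.2 i) (hs_dom i)
  have hobj' : ∀ᶠ θ in 𝓝[>] (0 : ℝ),
      AffineMap.lineMap y y' (θ * s) ∈ dom fun y => -P.obj y := by
    have hθs : Tendsto (fun θ => θ * s) (𝓝[>] 0) (𝓝 0) :=
      (Continuous.tendsto' (by fun_prop) 0 0 (zero_mul s)).mono_left nhdsWithin_le_nhds
    exact hθs.eventually
      (eventually_lineMap_mem_of_mem_intrinsicInterior hy.2 (subset_affineSpan ℝ _ hobj))
  obtain ⟨θ, ⟨hθ_neg, hθ_obj⟩, hθ⟩ := ((hneg.and hobj').and self_mem_nhdsWithin).exists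
  exact ⟨θ * s, mul_neg_of_pos_of_neg hθ hs, fun i => (hθ_neg i).le, hθ_obj⟩

end Slater

section WeakDuality

variable {E E' ι ι' κ κ' : Type*} {P : Program E ι κ} {D : Program E' ι' κ'}

theorem mem_dom_neg_iff {X : Type*} {h : X → EReal} {y : X} :
    (y ∈ dom fun y => -h y) ↔ ∃ r : ℝ, (r : EReal) ≤ h y := by
  constructor
  · intro hy
    obtain ⟨r, hr, -⟩ := EReal.lt_iff_exists_real_btwn.1 (show -h y < ⊤ from hy)
    exact ⟨-r, by simpa using EReal.neg_le_of_neg_le hr.le⟩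
  · rintro ⟨r, hr⟩
    exact (EReal.neg_le_neg_iff.2 hr).trans_lt (EReal.coe_lt_top (-r))

theorem Program.infimum_eq_supremum_and_maxSolvable (hweak : D.supremum ≤ P.infimum)
    (htop : P.infimum ≠ ⊤)
    (h : ∀ m : ℝ, P.infimum = m → ∃ y ∈ D.constraintSet, (m : EReal) ≤ D.obj y) :
    P.infimum = D.supremum ∧ D.MaxSolvable := by
  have hle {y} (hy : y ∈ D.constraintSet) : D.obj y ≤ D.supremum := le_iSup₂_of_le y hy le_rfl
  induction hm : P.infimum with
  | bot =>
    have hsup : D.supremum = ⊥ := le_bot_iff.1 (hm ▸ hweak)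
    exact ⟨hsup.symm, fun ⟨y, hy, hne⟩ => absurd (le_bot_iff.1 (hsup ▸ hle hy)) hne⟩
  | top => exact absurd hm htop
  | coe m =>
    obtain ⟨y, hy, hmy⟩ := h m hm
    have heq : (m : EReal) = D.supremum := le_antisymm (hmy.trans (hle hy)) (hm ▸ hweak)
    exact ⟨heq, fun _ => ⟨y, ⟨hy, ne_bot_of_le_ne_bot (EReal.coe_ne_bot m) hmy⟩,
      le_antisymm (hle hy) (heq ▸ hmy)⟩⟩

theorem Program.infimum_eq_supremum_and_minSolvable (hweak : D.supremum ≤ P.infimum)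
    (hbot : D.supremum ≠ ⊥)
    (h : ∀ v : ℝ, D.supremum = v → ∃ x ∈ P.constraintSet, P.obj x ≤ v) :
    P.infimum = D.supremum ∧ P.MinSolvable := by
  have hle {x} (hx : x ∈ P.constraintSet) : P.infimum ≤ P.obj x := iInf₂_le_of_le x hx le_rfl
  induction hv : D.supremum with
  | top =>
    have hinf : P.infimum = ⊤ := top_le_iff.1 (hv ▸ hweak)
    exact ⟨hinf, fun ⟨x, hx, hne⟩ => absurd (top_le_iff.1 (hinf ▸ hle hx)) hne⟩
  | bot => exact absurd hv hbot
  | coe v =>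
    obtain ⟨x, hx, hxv⟩ := h v hv
    have heq : P.infimum = v := le_antisymm ((hle hx).trans hxv) (hv ▸ hweak)
    exact ⟨heq, fun _ => ⟨x, ⟨hx, ne_top_of_le_ne_top (EReal.coe_ne_top v) hxv⟩,
      le_antisymm (heq ▸ hxv) (hle hx)⟩⟩

end WeakDuality

section Lagrangian

/-- The Lagrangian of the functions `g i`, where the `i`-th one carries the weight `μ i` and is
evaluated at its own copy `ζ i` of the uncertain parameter. -/
def lagrangian {ι E F : Type*} [Fintype ι] (g : ι → E → F → ℝ) (μ : ι → ℝ) (ζ : ι → F) (x : E) :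
    ℝ :=
  ∑ i, μ i * g i x (ζ i)

section Weights

variable {ι E F : Type*} [Fintype ι] {g : ι → E → F → ℝ} {μ ν : ι → ℝ}

theorem lagrangian_smul (a : ℝ) (ζ : ι → F) (x : E) :
    lagrangian g (a • μ) ζ x = a * lagrangian g μ ζ x := by
  simp only [lagrangian, Pi.smul_apply, smul_eq_mul, mul_assoc, Finset.mul_sum]

theorem convexOn_lagrangian [AddCommGroup E] [Module ℝ E] {S : Set E} (hS : Convex ℝ S)
    {ζ : ι → F} (hg : ∀ i, ConvexOn ℝ S fun x => g i x (ζ i)) (hμ : ∀ i, 0 ≤ μ i) :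
    ConvexOn ℝ S (lagrangian g μ ζ) :=
  convexOn_sum hS fun i _ => (hg i).smul (hμ i)

variable [AddCommGroup F] [Module ℝ F] {Z : Set F}

theorem concaveOn_lagrangian {x : E} (hZ : Convex ℝ Z) (hg : ∀ i, ConcaveOn ℝ Z (g i x))
    (hμ : ∀ i, 0 ≤ μ i) : ConcaveOn ℝ (univ.pi fun _ => Z) fun ζ => lagrangian g μ ζ x := by
  refine ⟨convex_pi fun _ _ => hZ, fun ζ hζ ξ hξ a b ha hb hab => ?_⟩
  simp only [lagrangian, Finset.smul_sum, ← Finset.sum_add_distrib]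
  exact Finset.sum_le_sum fun i _ =>
    ((hg i).smul (hμ i)).2 (hζ i trivial) (hξ i trivial) ha hb hab

theorem exists_mul_add_mul_le_of_concaveOn {h : E → F → ℝ} (hZ : Convex ℝ Z)
    (hh : ∀ x, ConcaveOn ℝ Z (h x)) {s t : ℝ} (hs : 0 ≤ s) (ht : 0 ≤ t) {z z' : F} (hz : z ∈ Z)
    (hz' : z' ∈ Z) : ∃ y ∈ Z, ∀ x, s * h x z + t * h x z' ≤ (s + t) * h x y := by
  rcases (add_nonneg hs ht).eq_or_lt with h0 | hpos
  · obtain ⟨rfl, rfl⟩ := (add_eq_zero_iff_of_nonneg hs ht).1 h0.symm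
    exact ⟨z, hz, fun x => by simp⟩
  have hst : s / (s + t) + t / (s + t) = 1 := by rw [← add_div, div_self hpos.ne']
  refine ⟨_, hZ hz hz' (by positivity) (by positivity) hst, fun x => ?_⟩
  have := (hh x).2 hz hz' (by positivity) (by positivity) hst
  rwa [smul_eq_mul, smul_eq_mul, div_mul_eq_mul_div, div_mul_eq_mul_div, ← add_div,
    div_le_iff₀' hpos] at this

/-- The Lagrangian is not jointly concave in `(μ, ζ)`. Mixing each `ζ i` and `ξ i` in proportion to
their weights makes up for it. -/
theorem exists_add_lagrangian_le (hZ : Convex ℝ Z) (hg : ∀ i x, ConcaveOn ℝ Z (g i x))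
    (hμ : ∀ i, 0 ≤ μ i) (hν : ∀ i, 0 ≤ ν i) {ζ ξ : ι → F} (hζ : ∀ i, ζ i ∈ Z)
    (hξ : ∀ i, ξ i ∈ Z) :
    ∃ θ : ι → F, (∀ i, θ i ∈ Z) ∧
      ∀ x, lagrangian g μ ζ x + lagrangian g ν ξ x ≤ lagrangian g (μ + ν) θ x := by
  choose θ hθ hle using fun i =>
    exists_mul_add_mul_le_of_concaveOn hZ (hg i) (hμ i) (hν i) (hζ i) (hξ i)
  refine ⟨θ, hθ, fun x => ?_⟩
  rw [lagrangian, lagrangian, ← Finset.sum_add_distrib]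
  exact Finset.sum_le_sum fun i _ => hle i x

end Weights

section Minimax

variable {ι E F : Type*} [Fintype ι] {g : ι → E → F → ℝ} {μ : ι → ℝ}

theorem upperSemicontinuous_lagrangian [TopologicalSpace F] {x : E}
    (hg : ∀ i, UpperSemicontinuous (g i x)) (hμ : ∀ i, 0 ≤ μ i) :
    UpperSemicontinuous fun ζ => lagrangian g μ ζ x :=
  upperSemicontinuous_sum fun i _ =>
    Continuous.comp_upperSemicontinuous (continuous_const_mul (μ i))
      ((hg i).comp (continuous_apply i)) (monotone_mul_left_of_nonneg (hμ i))

theorem exists_forall_le_lagrangian [NormedAddCommGroup E] [NormedSpace ℝ E]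
    [FiniteDimensional ℝ E] [TopologicalSpace F] [AddCommGroup F] [Module ℝ F]
    [IsTopologicalAddGroup F] [ContinuousSMul ℝ F] {Z : Set F} (hZc : Convex ℝ Z)
    (hZne : Z.Nonempty) (hZ : IsCompact Z) (hgx : ∀ i z, ConvexOn ℝ univ fun x => g i x z)
    (hgz : ∀ i x, ConcaveOn ℝ Z (g i x)) (hgu : ∀ i x, UpperSemicontinuous (g i x))
    (hμ : ∀ i, 0 ≤ μ i) {m : ℝ}
    (hm : ∀ x, ∃ ζ : ι → F, (∀ i, ζ i ∈ Z) ∧ m ≤ lagrangian g μ ζ x) :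
    ∃ ζ : ι → F, (∀ i, ζ i ∈ Z) ∧ ∀ x, m ≤ lagrangian g μ ζ x := by
  have hconv (ζ : ι → F) : ConvexOn ℝ univ (lagrangian g μ ζ) :=
    convexOn_lagrangian convex_univ (fun i => hgx i (ζ i)) hμ
  simp only [← mem_univ_pi (t := fun _ => Z)] at hm ⊢
  refine exists_forall_le_of_forall_exists_le (univ_pi_nonempty_iff.2 fun _ => hZne)
    (isCompact_univ_pi fun _ => hZ) (convex_pi fun _ _ => hZc)
    (h := fun x ζ => lagrangian g μ ζ x)
    (fun ζ _ => (hconv ζ).quasiconvexOn)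
    (fun ζ _ => (continuousOn_univ.1 ((hconv ζ).continuousOn isOpen_univ)).lowerSemicontinuous)
    (fun x => (concaveOn_lagrangian hZc (hgz · x) hμ).quasiconcaveOn)
    (fun x => (upperSemicontinuous_lagrangian (hgu · x) hμ).upperSemicontinuousOn _) hm

end Minimax

/-- The weights of the Lagrangian: `1` for the objective, `l i` for the `i`-th constraint. -/
def multipliers {I : ℕ} (l : Fin I → ℝ) : Fin (I + 1) → ℝ := Fin.cons 1 l

section Multipliers

variable {I : ℕ} {l l' : Fin I → ℝ}

theorem multipliers_nonneg (hl : ∀ i, 0 ≤ l i) (i : Fin (I + 1)) : 0 ≤ multipliers l i :=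
  Fin.cases zero_le_one hl i

theorem smul_multipliers_add_smul {a b : ℝ} (hab : a + b = 1) :
    a • multipliers l + b • multipliers l' = multipliers (a • l + b • l') := by
  ext i
  cases i using Fin.cases <;> simp [multipliers, hab]

theorem lagrangian_multipliers {E F : Type*} (g : Fin (I + 1) → E → F → ℝ) (ζ : Fin (I + 1) → F)
    (x : E) : lagrangian g (multipliers l) ζ x =
      g 0 x (ζ 0) + ∑ i : Fin I, l i * g i.succ x (ζ i.succ) := by
  simp only [lagrangian, Fin.sum_univ_succ, multipliers, Fin.cons_zero, Fin.cons_succ, one_mul]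

end Multipliers

section DualHypograph

variable {I : ℕ} {E F : Type*} [NormedAddCommGroup E] [InnerProductSpace ℝ E]

/-- The set of `(u, r)` such that `r` is a lower bound of `lagrangian g (multipliers l) ζ - ⟪·, u⟫`
for some multipliers `l ≥ 0` and some `ζ` in `Z`. Over `u = 0`, it describes the lower bounds that
Lagrangian duality provides; the other fibres are the perturbations of that dual problem. -/
def dualHypograph (g : Fin (I + 1) → E → F → ℝ) (Z : Set F) : Set (E × ℝ) :=
  {q | ∃ l : Fin I → ℝ, (∀ i, 0 ≤ l i) ∧ ∃ ζ : Fin (I + 1) → F, (∀ i, ζ i ∈ Z) ∧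
    ∀ x, q.2 + inner ℝ x q.1 ≤ lagrangian g (multipliers l) ζ x}

variable {g : Fin (I + 1) → E → F → ℝ} {Z : Set F}

theorem convex_dualHypograph [AddCommGroup F] [Module ℝ F] (hZ : Convex ℝ Z)
    (hg : ∀ i x, ConcaveOn ℝ Z (g i x)) : Convex ℝ (dualHypograph g Z) := by
  rintro ⟨u, r⟩ ⟨l, hl, ζ, hζ, h⟩ ⟨u', r'⟩ ⟨l', hl', ζ', hζ', h'⟩ a b ha hb hab
  obtain ⟨θ, hθ, hle⟩ := exists_add_lagrangian_le hZ hg (μ := a • multipliers l)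
    (ν := b • multipliers l') (fun i => mul_nonneg ha (multipliers_nonneg hl i))
    (fun i => mul_nonneg hb (multipliers_nonneg hl' i)) hζ hζ'
  refine ⟨a • l + b • l',
    fun i => add_nonneg (mul_nonneg ha (hl i)) (mul_nonneg hb (hl' i)), θ, hθ, fun x => ?_⟩
  rw [← smul_multipliers_add_smul hab]
  refine le_trans ?_ (hle x)
  rw [lagrangian_smul, lagrangian_smul]
  calc (a • (u, r) + b • (u', r')).2 + inner ℝ x (a • (u, r) + b • (u', r')).1
      = a * (r + inner ℝ x u) + b * (r' + inner ℝ x u') := by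
        simp only [Prod.snd_add, Prod.smul_snd, Prod.fst_add, Prod.smul_fst, inner_add_right,
          inner_smul_right, smul_eq_mul]
        ring
    _ ≤ _ := add_le_add (mul_le_mul_of_nonneg_left (h x) ha) (mul_le_mul_of_nonneg_left (h' x) hb)

variable [FiniteDimensional ℝ E]

theorem exists_eq_inner (φ : E →ₗ[ℝ] ℝ) : ∃ w : E, ∀ x, φ x = inner ℝ x w := by
  have := FiniteDimensional.complete ℝ E
  refine ⟨(InnerProductSpace.toDual ℝ E).symm φ.toContinuousLinearMap, fun x => ?_⟩
  rw [real_inner_comm, InnerProductSpace.toDual_symm_apply, LinearMap.coe_toContinuousLinearMap']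

theorem exists_forall_lagrangian_le [AddCommGroup F] [Module ℝ F] (hZ : Convex ℝ Z)
    (hgx : ∀ i z, ConvexOn ℝ univ fun x => g i x z) (hgz : ∀ i x, ConcaveOn ℝ Z (g i x))
    {r₀ v : ℝ} (h₀ : (0, r₀) ∈ dualHypograph g Z) (hv : ∀ r, (0, r) ∈ dualHypograph g Z → r ≤ v)
    (hcore : ∀ q ∈ dualHypograph g Z, ∃ s < (0 : ℝ), ∃ r, (s • q.1, r) ∈ dualHypograph g Z) :
    ∃ x, ∀ l : Fin I → ℝ, (∀ i, 0 ≤ l i) → ∀ ζ : Fin (I + 1) → F, (∀ i, ζ i ∈ Z) →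
      lagrangian g (multipliers l) ζ x ≤ v := by
  obtain ⟨φ, hφ⟩ :=
    exists_linear_bound_of_convex_of_mem_core (convex_dualHypograph hZ hgz) h₀ hv hcore
  obtain ⟨x, hx⟩ := exists_eq_inner (-φ)
  refine ⟨x, fun l hl ζ hζ => ?_⟩
  obtain ⟨ψ, hψ⟩ := exists_subgradient
    (convexOn_lagrangian convex_univ (fun i => hgx i (ζ i)) (multipliers_nonneg hl)) x
  obtain ⟨u, hu⟩ := exists_eq_inner ψ
  have hmem : (u, lagrangian g (multipliers l) ζ x - inner ℝ x u) ∈ dualHypograph g Z := by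
    refine ⟨l, hl, ζ, hζ, fun y => ?_⟩
    have := hψ y
    rw [hu, inner_sub_left] at this
    linarith
  have hle : lagrangian g (multipliers l) ζ x - inner ℝ x u ≤ v + φ u := hφ _ hmem
  have hxu : -φ u = inner ℝ x u := by rw [real_inner_comm, ← hx, LinearMap.neg_apply]
  linarith

end DualHypograph

end Lagrangian

section UncertaintySet

variable {L dz : ℕ} {c : Fin L → Vec dz → EReal}

theorem convex_uncertaintySet (hc : ∀ l, IsConvexFun (c l)) : Convex ℝ (uncertaintySet c) := by
  rw [uncertaintySet, ofPred_forall]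
  exact convex_iInter fun l => (hc l).convex_sublevel_zero

theorem isClosed_uncertaintySet (hc : ∀ l, LowerSemicontinuous (c l)) :
    IsClosed (uncertaintySet c) := by
  rw [uncertaintySet, ofPred_forall]
  exact isClosed_iInter fun l => (hc l).isClosed_preimage 0

end UncertaintySet

section RealData

theorem exists_eq_coe_of_isProper {E F : Type*} {f : E → F → EReal}
    (hx : ∀ z, IsProper fun x => f x z) (hz : ∀ x, IsProper fun z => -f x z) :
    ∃ g : E → F → ℝ, f = fun x z => (g x z : EReal) := by
  refine ⟨fun x z => (f x z).toReal, funext₂ fun x z => (EReal.coe_toReal ?_ ?_).symm⟩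
  · intro htop
    simpa only [htop, EReal.neg_top, lt_irrefl] using (hz x).1 z
  · exact ((hx z).1 x).ne'

theorem upperSemicontinuous_of_lowerSemicontinuous_neg_coe {E : Type*} [TopologicalSpace E]
    {h : E → ℝ} (hh : LowerSemicontinuous fun x => -(h x : EReal)) : UpperSemicontinuous h :=
  fun x a ha => by
    simp only [← EReal.coe_neg] at hh
    simpa using hh x (-a : ℝ) (by simpa using ha)

theorem exists_real_saddle {ι : Type*} {dx dz : ℕ} {f : ι → Vec dx → Vec dz → EReal}
    (hx : ∀ i z, IsPCC fun x => f i x z) (hz : ∀ i x, IsPCC fun z => -f i x z) :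
    ∃ g : ι → Vec dx → Vec dz → ℝ, (f = fun i x z => (g i x z : EReal)) ∧
      (∀ i z, ConvexOn ℝ univ fun x => g i x z) ∧ (∀ i x, ConcaveOn ℝ univ (g i x)) ∧
      ∀ i x, UpperSemicontinuous (g i x) := by
  choose g hg using fun i => exists_eq_coe_of_isProper (fun z => (hx i z).1) fun x => (hz i x).1
  obtain rfl : f = fun i x z => (g i x z : EReal) := funext hg
  refine ⟨g, rfl, fun i z => isConvexFun_coe_iff.1 (hx i z).2.2, fun i x => ?_, fun i x =>
    upperSemicontinuous_of_lowerSemicontinuous_neg_coe (hz i x).2.1.1⟩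
  have hconv := (hz i x).2.2
  simp only [← EReal.coe_neg] at hconv
  exact neg_convexOn_iff.1 (isConvexFun_coe_iff.1 hconv)

variable {dx dz : ℕ} {Z : Set (Vec dz)} {h : Vec dx → Vec dz → ℝ}

theorem worstCase_coe_le_iff {x : Vec dx} {r : ℝ} :
    worstCase Z (fun x z => (h x z : EReal)) x ≤ r ↔ ∀ z ∈ Z, h x z ≤ r := by
  simp only [worstCase, iSup_le_iff, EReal.coe_le_coe_iff]

theorem exists_real_worstCase (hne : Z.Nonempty) (hZ : IsCompact Z)
    (hx : ∀ z, ConvexOn ℝ univ fun x => h x z) (hz : ∀ x, UpperSemicontinuous (h x)) :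
    ∃ F : Vec dx → ℝ, (worstCase Z fun x z => (h x z : EReal)) = (fun x => (F x : EReal)) ∧
      ConvexOn ℝ univ F ∧ ∀ x, ∃ z ∈ Z, F x = h x z := by
  choose ζ hζ hmax using fun x => ((hz x).upperSemicontinuousOn Z).exists_isMaxOn hne hZ
  refine ⟨fun x => h x (ζ x), funext fun x => ?_, ⟨convex_univ, ?_⟩, fun x => ⟨ζ x, hζ x, rfl⟩⟩
  · refine le_antisymm (worstCase_coe_le_iff.2 fun z hzZ => hmax x hzZ) ?_
    exact le_iSup₂_of_le (ζ x) (hζ x) le_rfl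
  · intro x _ y _ a b ha hb hab
    refine ((hx _).2 trivial trivial ha hb hab).trans ?_
    exact add_le_add (mul_le_mul_of_nonneg_left (hmax x (hζ _)) ha)
      (mul_le_mul_of_nonneg_left (hmax y (hζ _)) hb)

end RealData

section Programs

variable {I L dx dz : ℕ}

/-- The primal worst problem with real-valued data. -/
abbrev realPrimal (g : Fin (I + 1) → Vec dx → Vec dz → ℝ) (c : Fin L → Vec dz → EReal) :
    Program (Vec dx) (Fin I) Empty :=
  primalWorst (fun i x z => (g i x z : EReal)) c

/-- The dual best problem with real-valued data. -/
abbrev realDual (g : Fin (I + 1) → Vec dx → Vec dz → ℝ) (c : Fin L → Vec dz → EReal) :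
    Program (DualVar I dx dz) (Fin I ⊕ (Fin (I + 1) × Fin L)) (Fin dx) :=
  dualBest (fun i x z => (g i x z : EReal)) c

variable {g : Fin (I + 1) → Vec dx → Vec dz → ℝ} {c : Fin L → Vec dz → EReal}

section Primal

theorem mem_realPrimal_constraintSet_iff {x : Vec dx} :
    x ∈ (realPrimal g c).constraintSet ↔
      ∀ i : Fin I, ∀ z ∈ uncertaintySet c, g i.succ x z ≤ 0 := by
  simp only [Program.constraintSet, primalWorst, mem_ofPred_eq, IsEmpty.forall_iff, and_true,
    ← EReal.coe_zero, worstCase_coe_le_iff]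

theorem mem_realPrimal_constraintSet_and_obj_le_iff {x : Vec dx} {v : ℝ} :
    (x ∈ (realPrimal g c).constraintSet ∧ (realPrimal g c).obj x ≤ v) ↔
      ∀ l : Fin I → ℝ, (∀ i, 0 ≤ l i) → ∀ ζ : Fin (I + 1) → Vec dz,
        (∀ i, ζ i ∈ uncertaintySet c) → lagrangian g (multipliers l) ζ x ≤ v := by
  have hobj : (realPrimal g c).obj x ≤ v ↔ ∀ z ∈ uncertaintySet c, g 0 x z ≤ v :=
    worstCase_coe_le_iff
  rw [mem_realPrimal_constraintSet_iff, hobj]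
  simp only [lagrangian_multipliers]
  constructor
  · rintro ⟨hx, hv⟩ l hl ζ hζ
    have : ∑ i : Fin I, l i * g i.succ x (ζ i.succ) ≤ 0 := Finset.sum_nonpos fun i _ =>
      mul_nonpos_of_nonneg_of_nonpos (hl i) (hx i _ (hζ _))
    linarith [hv _ (hζ 0)]
  · intro h
    refine ⟨fun i z hz => ?_, fun z hz => ?_⟩
    · refine neg_nonneg.1 (nonneg_of_forall_le_add_mul (a := g 0 x z) (b := v) fun t ht => ?_)
      have := h (Pi.single i t) (fun j => (Pi.single_nonneg (α := fun _ => ℝ)).2 ht j) (fun _ => z)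
        fun _ => hz
      simp only [Pi.single_apply, ite_mul, zero_mul, Finset.sum_ite_eq', Finset.mem_univ,
        if_true] at this
      linarith
    · simpa using h 0 (fun _ => le_rfl) (fun _ => z) fun _ => hz

end Primal

section Dual

theorem mem_realDual_constraintSet_iff {w : Fin (I + 1) → Vec dx} {z : Fin (I + 1) → Vec dz}
    {l : Fin I → ℝ} : (w, z, l) ∈ (realDual g c).constraintSet ↔
      ∑ i, w i = 0 ∧ (∀ i, z i ∈ uncertaintySet c) ∧ ∀ i, 0 ≤ l i := by
  have heqn : (∀ k, (((∑ i, w i) k : ℝ) : EReal) = 0) ↔ ∑ i, w i = 0 := by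
    simp only [EReal.coe_eq_zero, PiLp.ext_iff, PiLp.zero_apply]
  have hmul : (∀ i, ((-l i : ℝ) : EReal) ≤ 0) ↔ ∀ i, 0 ≤ l i := by
    simp only [EReal.coe_nonpos, Left.neg_nonpos_iff]
  rw [← heqn, ← hmul]
  simp only [Program.constraintSet, dualBest, mem_ofPred_eq, Sum.forall, Sum.elim_inl,
    Sum.elim_inr, Prod.forall, uncertaintySet]
  tauto

theorem realDual_obj_eq {w : Fin (I + 1) → Vec dx} {z : Fin (I + 1) → Vec dz} {l : Fin I → ℝ}
    (hl : ∀ i, 0 ≤ l i) :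
    (realDual g c).obj (w, z, l) = -⨆ y : Fin (I + 1) → Vec dx,
      ((∑ i, (inner ℝ (y i) (w i) - multipliers l i * g i (y i) (z i)) : ℝ) : EReal) := by
  let h (i : Fin (I + 1)) (x : Vec dx) : ℝ := inner ℝ x (w i) - multipliers l i * g i x (z i)
  have h_zero : partialConj (fun x z => (g 0 x z : EReal)) (w 0) (z 0) = ⨆ x, (h 0 x : EReal) := by
    simp [h, partialConj, conj_coe, multipliers]
  have h_succ (i : Fin I) : partialConjPerspective (fun x z => (g i.succ x z : EReal)) (w i.succ)
      (l i) (z i.succ) = ⨆ x, (h i.succ x : EReal) :=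
    perspective_conj_coe (hl i)
  have hsum : ∑ i : Fin I, ⨆ x, (h i.succ x : EReal) ≠ ⊥ := by
    simp only [sum_iSup_eq_iSup_sum, ← ereal_coe_sum]
    exact iSup_coe_ne_bot _
  simp only [dualBest, h_zero, h_succ]
  rw [← EReal.neg_add (.inl (iSup_coe_ne_bot _)) (.inr hsum),
    ← Fin.sum_univ_succ fun i => ⨆ x, (h i x : EReal), sum_iSup_eq_iSup_sum]
  simp only [ereal_coe_sum, h]

theorem coe_le_realDual_obj_iff {w : Fin (I + 1) → Vec dx} {z : Fin (I + 1) → Vec dz}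
    {l : Fin I → ℝ} (hl : ∀ i, 0 ≤ l i) {r : ℝ} :
    (r : EReal) ≤ (realDual g c).obj (w, z, l) ↔ ∀ y : Fin (I + 1) → Vec dx,
      r + ∑ i, inner ℝ (y i) (w i) ≤ ∑ i, multipliers l i * g i (y i) (z i) := by
  rw [realDual_obj_eq hl, EReal.le_neg, iSup_le_iff]
  refine forall_congr' fun y => ?_
  rw [← EReal.coe_neg, EReal.coe_le_coe_iff, Finset.sum_sub_distrib, sub_le_iff_le_add,
    neg_add_eq_sub, le_sub_iff_add_le']

theorem exists_sum_eq_and_coe_le_realDual_obj_iff (hg : ∀ i z, ConvexOn ℝ univ fun x => g i x z)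
    {z : Fin (I + 1) → Vec dz} {l : Fin I → ℝ} (hl : ∀ i, 0 ≤ l i) {u : Vec dx} {r : ℝ} :
    (∃ w, ∑ i, w i = u ∧ (r : EReal) ≤ (realDual g c).obj (w, z, l)) ↔
      ∀ x, r + inner ℝ x u ≤ lagrangian g (multipliers l) z x := by
  simp only [coe_le_realDual_obj_iff hl]
  constructor
  · rintro ⟨w, rfl, hw⟩ x
    rw [inner_sum]
    exact hw fun _ => x
  · intro h
    obtain ⟨φ, hφu, hφ⟩ := exists_linear_split_of_le_sum (u := (innerₗ (Vec dx)).flip u)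
      (fun i => (hg i (z i)).smul (multipliers_nonneg hl i)) h
    choose w hw using fun i => exists_eq_inner (φ i)
    refine ⟨w, ext_inner_left ℝ fun x => ?_, fun y => ?_⟩
    · simpa only [LinearMap.sum_apply, hw, inner_sum, LinearMap.flip_apply, innerₗ_apply_apply]
        using LinearMap.congr_fun hφu x
    · simpa only [hw, smul_eq_mul] using hφ y

theorem mem_dualHypograph_iff (hg : ∀ i z, ConvexOn ℝ univ fun x => g i x z) {u : Vec dx} {r : ℝ} :
    (u, r) ∈ dualHypograph g (uncertaintySet c) ↔
      ∃ w z, ∃ l : Fin I → ℝ, ∑ i, w i = u ∧ (∀ i, z i ∈ uncertaintySet c) ∧ (∀ i, 0 ≤ l i) ∧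
        (r : EReal) ≤ (realDual g c).obj (w, z, l) := by
  constructor
  · rintro ⟨l, hl, z, hz, h⟩
    obtain ⟨w, hw, hr⟩ := (exists_sum_eq_and_coe_le_realDual_obj_iff hg hl).2 h
    exact ⟨w, z, l, hw, hz, hl, hr⟩
  · rintro ⟨w, z, l, hw, hz, hl, hr⟩
    exact ⟨l, hl, z, hz, (exists_sum_eq_and_coe_le_realDual_obj_iff hg hl).1 ⟨w, hw, hr⟩⟩

theorem zero_mem_dualHypograph_iff (hg : ∀ i z, ConvexOn ℝ univ fun x => g i x z) {r : ℝ} :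
    (0, r) ∈ dualHypograph g (uncertaintySet c) ↔
      ∃ y ∈ (realDual g c).constraintSet, (r : EReal) ≤ (realDual g c).obj y := by
  simp only [mem_dualHypograph_iff hg, Prod.exists, mem_realDual_constraintSet_iff, and_assoc]

theorem isConvexFun_realDual_ineq (hc : ∀ l, IsConvexFun (c l)) (j : Fin I ⊕ Fin (I + 1) × Fin L) :
    IsConvexFun ((realDual g c).ineq j) := by
  rcases j with i | ⟨i, k⟩
  · exact isConvexFun_coe_iff.2 (LinearMap.convexOn (-(LinearMap.proj i ∘ₗ LinearMap.snd ℝ _ _ ∘ₗ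
      LinearMap.snd ℝ _ _) : DualVar I dx dz →ₗ[ℝ] ℝ) convex_univ)
  · exact (hc k).comp_linearMap (LinearMap.proj i ∘ₗ LinearMap.fst ℝ _ _ ∘ₗ
      LinearMap.snd ℝ _ _ : DualVar I dx dz →ₗ[ℝ] Vec dz)

end Dual

theorem realDual_supremum_le_realPrimal_infimum
    (hg : ∀ i z, ConvexOn ℝ univ fun x => g i x z) :
    (realDual g c).supremum ≤ (realPrimal g c).infimum := by
  refine iSup₂_le fun y hy => le_iInf₂ fun x hx => ?_
  by_contra! hlt
  obtain ⟨v, hxv, hvy⟩ := EReal.lt_iff_exists_real_btwn.1 hlt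
  obtain ⟨r, hvr, hry⟩ := EReal.lt_iff_exists_real_btwn.1 hvy
  obtain ⟨l, hl, ζ, hζ, hr⟩ := (zero_mem_dualHypograph_iff hg).2 ⟨y, hy, hry.le⟩
  have hle := mem_realPrimal_constraintSet_and_obj_le_iff.1 ⟨hx, hxv.le⟩ l hl ζ hζ
  have hrx := (hr x).trans hle
  rw [inner_zero_right, add_zero] at hrx
  exact hrx.not_gt (EReal.coe_lt_coe_iff.1 hvr)

section StrongDuality

theorem exists_real_realPrimal (hne : (uncertaintySet c).Nonempty)
    (hZ : IsCompact (uncertaintySet c)) (hgx : ∀ i z, ConvexOn ℝ univ fun x => g i x z)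
    (hgu : ∀ i x, UpperSemicontinuous (g i x)) :
    ∃ F : Fin (I + 1) → Vec dx → ℝ, (∀ i, ConvexOn ℝ univ (F i)) ∧
      (∀ i x, ∃ z ∈ uncertaintySet c, F i x = g i x z) ∧
      (realPrimal g c).obj = (fun x => (F 0 x : EReal)) ∧
      (realPrimal g c).ineq = (fun i x => (F i.succ x : EReal)) ∧
      (realPrimal g c).constraintSet = {x | ∀ i : Fin I, F i.succ x ≤ 0} := by
  choose F hF hFc hFz using fun i => exists_real_worstCase hne hZ (hgx i) (hgu i)
  refine ⟨F, hFc, hFz, hF 0, funext fun i => hF i.succ, ?_⟩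
  ext x
  simp [Program.constraintSet, primalWorst, hF]

theorem exists_mem_realDual_constraintSet_of_multipliers (hZc : Convex ℝ (uncertaintySet c))
    (hne : (uncertaintySet c).Nonempty) (hZ : IsCompact (uncertaintySet c))
    (hgx : ∀ i z, ConvexOn ℝ univ fun x => g i x z) (hgz : ∀ i x, ConcaveOn ℝ univ (g i x))
    (hgu : ∀ i x, UpperSemicontinuous (g i x)) {F : Fin (I + 1) → Vec dx → ℝ}
    (hF : ∀ i x, ∃ z ∈ uncertaintySet c, F i x = g i x z) {l : Fin I → ℝ} (hl : ∀ i, 0 ≤ l i)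
    {m : ℝ} (hm : ∀ x, m ≤ F 0 x + ∑ i : Fin I, l i * F i.succ x) :
    ∃ y ∈ (realDual g c).constraintSet, (m : EReal) ≤ (realDual g c).obj y := by
  obtain ⟨ζ, hζ, hmζ⟩ := exists_forall_le_lagrangian hZc hne hZ hgx
    (fun i x => (hgz i x).subset (subset_univ _) hZc) hgu (multipliers_nonneg hl) (m := m)
    fun x => by
      choose ζ hζ hFζ using fun i => hF i x
      exact ⟨ζ, hζ, by simpa only [lagrangian_multipliers, hFζ] using hm x⟩
  exact (zero_mem_dualHypograph_iff hgx).1 ⟨l, hl, ζ, hζ, fun x => by simpa using hmζ x⟩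

theorem strongDuality_of_primal_slater (hZc : Convex ℝ (uncertaintySet c))
    (hne : (uncertaintySet c).Nonempty) (hZ : IsCompact (uncertaintySet c))
    (hgx : ∀ i z, ConvexOn ℝ univ fun x => g i x z) (hgz : ∀ i x, ConcaveOn ℝ univ (g i x))
    (hgu : ∀ i x, UpperSemicontinuous (g i x)) {x₀ : Vec dx}
    (hx₀ : ∀ i, (realPrimal g c).ineq i x₀ < 0) :
    (realPrimal g c).infimum = (realDual g c).supremum ∧ (realDual g c).MaxSolvable := by
  obtain ⟨F, hFc, hFz, hobj, hineq, hcon⟩ := exists_real_realPrimal hne hZ hgx hgu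
  have hslater (i : Fin I) : F i.succ x₀ < 0 := by simpa only [hineq, EReal.coe_neg'] using hx₀ i
  have hinf {x : Vec dx} (hx : ∀ i : Fin I, F i.succ x ≤ 0) :
      (realPrimal g c).infimum ≤ (F 0 x : ℝ) :=
    iInf₂_le_of_le x (hcon.ge hx) (congrFun hobj x).le
  refine Program.infimum_eq_supremum_and_maxSolvable
    (realDual_supremum_le_realPrimal_infimum hgx) ?_ fun m hm => ?_
  · exact ((hinf fun i => (hslater i).le).trans_lt (EReal.coe_lt_top _)).ne
  · obtain ⟨l, hl, hml⟩ := exists_lagrange_multipliers_of_slater (hFc 0)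
      (fun i : Fin I => hFc i.succ) hslater fun x hx => EReal.coe_le_coe_iff.1 (hm ▸ hinf hx)
    exact exists_mem_realDual_constraintSet_of_multipliers hZc hne hZ hgx hgz hgu hFz hl hml

theorem strongDuality_of_isBounded (hZc : Convex ℝ (uncertaintySet c))
    (hne : (uncertaintySet c).Nonempty) (hZ : IsCompact (uncertaintySet c))
    (hgx : ∀ i z, ConvexOn ℝ univ fun x => g i x z) (hgz : ∀ i x, ConcaveOn ℝ univ (g i x))
    (hgu : ∀ i x, UpperSemicontinuous (g i x)) (hfeas : (realPrimal g c).minFeasible.Nonempty)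
    (hbd : Bornology.IsBounded (realPrimal g c).minFeasible) :
    (realPrimal g c).infimum = (realDual g c).supremum ∧ (realPrimal g c).MinSolvable := by
  obtain ⟨F, hFc, hFz, hobj, -, hcon⟩ := exists_real_realPrimal hne hZ hgx hgu
  have hmin : (realPrimal g c).minFeasible = {x | ∀ i : Fin I, F i.succ x ≤ 0} := by
    simp only [Program.minFeasible, hcon, hobj, mem_ofPred_eq, ne_eq, EReal.coe_ne_top,
      not_false_eq_true, and_true]
  have hcont (i : Fin (I + 1)) : Continuous (F i) :=
    continuousOn_univ.1 ((hFc i).continuousOn isOpen_univ)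
  rw [hmin] at hfeas hbd
  have hclosed : IsClosed {x | ∀ i : Fin I, F i.succ x ≤ 0} := by
    rw [ofPred_forall]
    exact isClosed_iInter fun i => isClosed_le (hcont _) continuous_const
  obtain ⟨x, hx, hxmin⟩ := (Metric.isCompact_of_isClosed_isBounded hclosed hbd).exists_isMinOn hfeas
    (hcont 0).continuousOn
  have hinf : (realPrimal g c).infimum = (F 0 x : ℝ) := by
    simp only [Program.infimum, hcon, hobj]
    exact le_antisymm (iInf₂_le x hx) (le_iInf₂ fun y hy => EReal.coe_le_coe_iff.2 (hxmin hy))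
  refine ⟨le_antisymm ?_ (realDual_supremum_le_realPrimal_infimum hgx),
    fun _ => ⟨x, hmin.ge hx, (congrFun hobj x).trans hinf.symm⟩⟩
  refine hinf.trans_le (EReal.ge_of_forall_gt_iff_ge.1 fun t ht => ?_)
  obtain ⟨l, hl, htl⟩ := exists_lagrange_multipliers_of_isBounded (hFc 0)
    (fun i : Fin I => hFc i.succ) hfeas hbd (fun y hy => hxmin hy) (EReal.coe_lt_coe_iff.1 ht)
  obtain ⟨y, hy, hty⟩ :=
    exists_mem_realDual_constraintSet_of_multipliers hZc hne hZ hgx hgz hgu hFz hl htl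
  exact le_iSup₂_of_le y hy hty

/-- The relative interior in Slater's condition makes `0` a relative core point of the projection of
`dualHypograph`: the segment from a dual point to the Slater point extends a little beyond it. -/
theorem exists_neg_smul_mem_dualHypograph (hc : ∀ l, IsConvexFun (c l))
    (hgx : ∀ i z, ConvexOn ℝ univ fun x => g i x z) {y : DualVar I dx dz}
    (hy : (realDual g c).IsMaxStrictSlater y) {q : Vec dx × ℝ}
    (hq : q ∈ dualHypograph g (uncertaintySet c)) :
    ∃ s < (0 : ℝ), ∃ r, (s • q.1, r) ∈ dualHypograph g (uncertaintySet c) := by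
  obtain ⟨w', z', l', hw', hz', hl', hq'⟩ := (mem_dualHypograph_iff hgx).1 hq
  have hineq : ∀ i, (realDual g c).ineq i (w', z', l') ≤ 0 := by
    rintro (i | ⟨i, k⟩)
    · simpa [dualBest] using hl' i
    · exact hz' i k
  obtain ⟨s, hs, hs_ineq, hs_obj⟩ := hy.exists_neg_lineMap_mem (isConvexFun_realDual_ineq hc)
    (fun i => (hineq i).trans_lt EReal.zero_lt_top) (mem_dom_neg_iff.2 ⟨q.2, hq'⟩)
  obtain ⟨r, hr⟩ := mem_dom_neg_iff.1 hs_obj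
  refine ⟨s, hs, r, (mem_dualHypograph_iff hgx).2 ⟨_, _, _, ?_, ?_, ?_, hr⟩⟩
  · have hw : ∑ i, y.1 i = 0 := (mem_realDual_constraintSet_iff.1 hy.1.2.2.1).1
    simp [Finset.sum_add_distrib, ← Finset.smul_sum, hw, hw']
  · exact fun i k => hs_ineq (.inr (i, k))
  · exact fun i => neg_nonpos.1 (EReal.coe_nonpos.1 (hs_ineq (.inl i)))

theorem strongDuality_of_dual_slater (hc : ∀ l, IsConvexFun (c l))
    (hgx : ∀ i z, ConvexOn ℝ univ fun x => g i x z) (hgz : ∀ i x, ConcaveOn ℝ univ (g i x))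
    {y : DualVar I dx dz} (hy : (realDual g c).IsMaxStrictSlater y) :
    (realPrimal g c).infimum = (realDual g c).supremum ∧ (realPrimal g c).MinSolvable := by
  have hle {y r} (hy : y ∈ (realDual g c).constraintSet) (hr : r ≤ (realDual g c).obj y) :
      r ≤ (realDual g c).supremum := le_iSup₂_of_le y hy hr
  obtain ⟨r₀, hr₀⟩ := mem_dom_neg_iff.1 (intrinsicInterior_subset hy.2)
  refine Program.infimum_eq_supremum_and_minSolvable
    (realDual_supremum_le_realPrimal_infimum hgx) ?_ fun v hv => ?_
  · exact ((EReal.bot_lt_coe r₀).trans_le (hle hy.1.2.2.1 hr₀)).ne'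
  have hZc := convex_uncertaintySet hc
  obtain ⟨x, hx⟩ := exists_forall_lagrangian_le hZc hgx
    (fun i x => (hgz i x).subset (subset_univ _) hZc)
    ((zero_mem_dualHypograph_iff hgx).2 ⟨y, hy.1.2.2.1, hr₀⟩)
    (fun r hr => by
      obtain ⟨y, hy, hry⟩ := (zero_mem_dualHypograph_iff hgx).1 hr
      exact EReal.coe_le_coe_iff.1 (hv ▸ hle hy hry))
    (fun q hq => exists_neg_smul_mem_dualHypograph hc hgx hy hq)
  exact ⟨x, mem_realPrimal_constraintSet_and_obj_le_iff.2 hx⟩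

end StrongDuality

end Programs

end RobustDuality

end

theorem mainTheorem1 (I L dx dz : ℕ)
    (f : Fin (I + 1) → RobustDuality.Vec dx → RobustDuality.Vec dz → EReal)
    (hf_x : ∀ i z, RobustDuality.IsPCC (fun x => f i x z))
    (hf_z : ∀ i x, RobustDuality.IsPCC (fun z => - f i x z))
    (c : Fin L → RobustDuality.Vec dz → EReal)
    (hc : ∀ l, RobustDuality.IsPCC (c l))
    (hZ : (RobustDuality.uncertaintySet c).Nonempty) :
    ((∃ x, (RobustDuality.primalWorst f c).IsMinStrictSlater x) →
      Bornology.IsBounded (RobustDuality.uncertaintySet c) →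
        (RobustDuality.primalWorst f c).infimum = (RobustDuality.dualBest f c).supremum ∧
        (RobustDuality.dualBest f c).MaxSolvable) ∧
    ((RobustDuality.primalWorst f c).minFeasible.Nonempty →
      Bornology.IsBounded (RobustDuality.primalWorst f c).minFeasible →
      Bornology.IsBounded (RobustDuality.uncertaintySet c) →
        (RobustDuality.primalWorst f c).infimum = (RobustDuality.dualBest f c).supremum ∧
        (RobustDuality.primalWorst f c).MinSolvable) ∧
    ((∃ y, (RobustDuality.dualBest f c).IsMaxStrictSlater y) →
        (RobustDuality.primalWorst f c).infimum = (RobustDuality.dualBest f c).supremum ∧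
        (RobustDuality.primalWorst f c).MinSolvable) := by
  obtain ⟨g, rfl, hgx, hgz, hgu⟩ := RobustDuality.exists_real_saddle hf_x hf_z
  have hZconv := RobustDuality.convex_uncertaintySet fun l => (hc l).2.2
  have hZcompact : Bornology.IsBounded (RobustDuality.uncertaintySet c) →
      IsCompact (RobustDuality.uncertaintySet c) :=
    Metric.isCompact_of_isClosed_isBounded
      (RobustDuality.isClosed_uncertaintySet fun l => (hc l).2.1.1)
  refine ⟨?_, ?_, ?_⟩
  · rintro ⟨x, hx⟩ hbd
    exact RobustDuality.strongDuality_of_primal_slater hZconv hZ (hZcompact hbd) hgx hgz hgu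
      hx.1.2.2.2
  · intro hfeas hfeas_bd hbd
    exact RobustDuality.strongDuality_of_isBounded hZconv hZ (hZcompact hbd) hgx hgz hgu hfeas
      hfeas_bd
  · rintro ⟨y, hy⟩
    exact RobustDuality.strongDuality_of_dual_slater (fun l => (hc l).2.2) hgx hgz hy
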